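/- A graphon $H=(\Omega,\mathcal A,\pi,W)$ consists of a probability space $(\Omega,\mathcal A,\pi)$ and a bounded symmetric function $W:\Omega\times\Omega\to\mathbb R$ that is measurable with respect to the completion of $(\Omega\times\Omega,\mathcal A\times\mathcal A,\pi\times\pi)$. It is Lebesguian if $(\Omega,\mathcal A,\pi)$ is a Lebesgue space, i.e. complete and isomorphic mod $0$ to the disjoint union of a closed interval (with Lebesgue measure) and a countable set of atoms. Multigraphs are finite and have no loops. For a multigraph $F$ with nodes $1,\dots,k$ let $t(F,H)=\int_{\Omega^k}\prod_{ij\in E(F)}W(x_i,x_j)\,d\pi(x_1)\cdots d\pi(x_k)$. A partially labeled multigraph is a multigraph some of whose nodes carry distinct labels from $\mathbb N=\{0,1,2,\dots\}$. For such an $F$ and $\alpha=(a_0,a_1,\dots)\in\Omega^{\mathbb N}$ let $t_\alpha(F,H)=\mathsf E\bigl(\prod_{ij\in E(F)}W(X_i,X_j)\bigr)$, where $X_i=a_\ell$ if node $i$ has label $\ell$, and where the $X_i$ for the unlabeled nodes $i$ are independent with distribution $\pi$. Let $H=(\Omega,\mathcal A,\pi,W)$ and $H'=(\Omega',\mathcal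 A',\pi',W')$ be two graphons. (1) Suppose that $H$ and $H'$ are Lebesguian and that $t(F,H)=t(F,H')$ for every multigraph $F$. Then there is a coupling of $(\Omega^{\mathbb N},\pi^{\mathbb N})$ and $(\Omega'^{\mathbb N},\pi'^{\mathbb N})$ (a probability measure on the product with these two marginals) such that, if $(\alpha,\beta)$ is drawn from it, then almost surely $t_\alpha(F,H)=t_\beta(F,H')$ for every partially labeled multigraph $F$. (2) Suppose that $0\le W\le 1$ and $0\le W'\le 1$. For $\alpha\in\Omega^{\mathbb N}$ let $\Phi_\alpha(x)=(W(x,a_0),W(x,a_1),\dots)\in[0,1]^{\mathbb N}$. If $\Phi_\alpha$ is measurable with respect to the completion of $\mathcal A$, let $\lambda_\alpha=\pi\circ\Phi_\alpha^{-1}$ be the distribution of the tags, a Borel probability measure on $[0,1]^{\mathbb N}$, and let $W_\alpha$ be the push-forward of $W$: the symmetric measurable function $[0,1]^{\mathbb N}\times[0,1]^{\mathbb N}\to[0,1]$, unique up to null sets, with $$\int_{A_1\times A_2}W_\alpha\,d\lambda_\alpha\,d\lambda_\alpha=\int_{\Phi_\alpha^{-1}(A_1)\times\Phi_\alpha^{-1}(A_2)}W\,d\pi\,d\pi$$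 for all Borel sets $A_1,A_2$. Call $\alpha$ regular for $H$ if $\Phi_\alpha$ is measurable in this sense and $W(x,y)=W_\alpha(\Phi_\alpha(x),\Phi_\alpha(y))$ for almost all $(x,y)$. Define $\lambda'_\beta$, $W'_\beta$ and regularity for $\beta\in\Omega'^{\mathbb N}$ and $H'$ in the same way. If $\alpha$ is regular for $H$, $\beta$ is regular for $H'$, and $t_\alpha(F,H)=t_\beta(F,H')$ for every partially labeled multigraph $F$, then $\lambda_\alpha=\lambda'_\beta$, and $W_\alpha=W'_\beta$ almost everywhere with respect to $\lambda_\alpha\times\lambda_\alpha$. -/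

import Mathlib

open MeasureTheory

open scoped ENNReal unitInterval

/-! ### Lebesgue spaces -/

/-- `φ` is an isomorphism mod `0` from `(α, μ)` to `(β, ν)`: it is measure preserving, and off null
sets `N ⊆ α`, `N' ⊆ β` it restricts to a bijection that is measurable and measure preserving in both
directions. -/
def IsIsoModZero {α β : Type*} [MeasurableSpace α] [MeasurableSpace β]
    (μ : Measure α) (ν : Measure β) (φ : α → β) : Prop :=
  MeasurePreserving φ μ ν ∧
    ∃ (N : Set α) (N' : Set β), MeasurableSet N ∧ μ N = 0 ∧ MeasurableSet N' ∧ ν N' = 0 ∧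
      ∃ e : ↥(Nᶜ) ≃ᵐ ↥(N'ᶜ), (∀ x, (e x : β) = φ x) ∧
        MeasurePreserving e (μ.comap Subtype.val) (ν.comap Subtype.val)

/-- The measure on the disjoint union of the closed interval `[a, b]` and a countable set `S` which
is the Lebesgue measure on the interval and puts mass `w i` on the point `i` of `S`. -/
noncomputable def intervalAtoms (a b : ℝ) (S : Set ℕ) (w : S → ℝ≥0∞) :
    Measure (↥(Set.Icc a b) ⊕ ↥S) :=
  Measure.map Sum.inl (Measure.comap Subtype.val (volume : Measure ℝ)) +
    Measure.sum fun i : S => w i • Measure.dirac (Sum.inr i)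

/-- A Lebesgue space: a complete probability space that is isomorphic mod `0` to the disjoint union
of a closed interval (with the Lebesgue measurable sets and the Lebesgue measure) and a countable
set of atoms.  The interval may have length `0`, and the set of atoms may be empty. -/
def IsLebesgueSpace {Ω : Type*} [MeasurableSpace Ω] (π : Measure Ω) : Prop :=
  IsProbabilityMeasure π ∧ π.IsComplete ∧
    ∃ (a b : ℝ) (S : Set ℕ) (w : S → ℝ≥0∞), a ≤ b ∧ (∀ i, 0 < w i) ∧
      ∃ φ : Ω → NullMeasurableSpace (↥(Set.Icc a b) ⊕ ↥S) (intervalAtoms a b S w),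
        IsIsoModZero π (intervalAtoms a b S w).completion φ

/-! ### Graphons -/

/-- A graphon on `(Ω, π)`: a bounded symmetric function `W : Ω × Ω → ℝ` which is measurable with
respect to the completion of the product space. -/
structure Graphon {Ω : Type*} [MeasurableSpace Ω] (π : Measure Ω) where
  W : Ω → Ω → ℝ
  symm : ∀ x y, W x y = W y x
  bounded : ∃ C : ℝ, ∀ x y, |W x y| ≤ C
  nullMeasurable : NullMeasurable (fun p : Ω × Ω => W p.1 p.2) (π.prod π)

/-- `0 ≤ W ≤ 1`. -/
def Graphon.UnitValued {Ω : Type*} [MeasurableSpace Ω] {π : Measure Ω} (H : Graphon π) : Prop :=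
  ∀ x y, H.W x y ∈ Set.Icc (0 : ℝ) 1

/-! ### Multigraphs and densities -/

/-- A multigraph with node set `V`: a finite multiset of edges (unordered pairs of nodes), no
loops. -/
structure Multigraph (V : Type*) where
  edges : Multiset (Sym2 V)
  loopless : ∀ e ∈ edges, ¬ e.IsDiag

/-- The value of `W` on the edge with end nodes `i`, `j`, if node `i` is mapped to `x i`. -/
def Graphon.edgeValue {Ω V : Type*} [MeasurableSpace Ω] {π : Measure Ω} (H : Graphon π)
    (x : V → Ω) : Sym2 V → ℝ :=
  Sym2.lift ⟨fun i j => H.W (x i) (x j), fun i j => H.symm (x i) (x j)⟩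

/-- `∏_{ij ∈ E(F)} W(x_i, x_j)`, the product counting edges with multiplicity. -/
def Graphon.edgeProd {Ω V : Type*} [MeasurableSpace Ω] {π : Measure Ω} (H : Graphon π)
    (F : Multigraph V) (x : V → Ω) : ℝ :=
  (F.edges.map (H.edgeValue x)).prod

/-- The density `t(F, H)`. -/
noncomputable def Graphon.density {Ω : Type*} [MeasurableSpace Ω] {π : Measure Ω} (H : Graphon π)
    {k : ℕ} (F : Multigraph (Fin k)) : ℝ :=
  ∫ x : Fin k → Ω, H.edgeProd F x ∂(Measure.pi fun _ => π)

/-- A partially labeled multigraph with `r` labeled nodes (the nodes `Sum.inl i`), carrying the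
distinct nonnegative integers `label i`, and `s` unlabeled nodes (the nodes `Sum.inr j`). -/
structure PartiallyLabeledMultigraph where
  r : ℕ
  s : ℕ
  label : Fin r ↪ ℕ
  graph : Multigraph (Fin r ⊕ Fin s)

/-- `t_α(F, H)`: the node with label `l` is mapped to `α l`, and the unlabeled nodes are mapped to
independent points with distribution `π`. -/
noncomputable def Graphon.labeledDensity {Ω : Type*} [MeasurableSpace Ω] {π : Measure Ω}
    (H : Graphon π) (α : ℕ → Ω) (F : PartiallyLabeledMultigraph) : ℝ :=
  ∫ x : Fin F.s → Ω, H.edgeProd F.graph (Sum.elim (fun i => α (F.label i)) x)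
    ∂(Measure.pi fun _ => π)

/-! ### Push-forward of a graphon -/

/-- The Radon-Nikodym derivative, with respect to the product of two copies of the image measure of
`π` under `φ`, of the measure `A ↦ ∫_{(φ × φ)⁻¹ A} W d(π × π)` (for `0 ≤ W ≤ 1`). -/
noncomputable def Graphon.pushDeriv {Ω Γ : Type*} [MeasurableSpace Ω] [MeasurableSpace Γ]
    {π : Measure Ω} (H : Graphon π) (φ : Ω → Γ) : Γ × Γ → ℝ≥0∞ :=
  (Measure.map (Prod.map φ φ)
      ((π.prod π).withDensity fun p => ENNReal.ofReal (H.W p.1 p.2))).rnDeriv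
    ((π.map φ).prod (π.map φ))

/-- The push-forward `W_φ` of a graphon with values in `[0, 1]`.  The Radon-Nikodym derivative is
symmetric and has values in `[0, 1]` almost everywhere; it is changed on a null set, by averaging and
truncating, so that this holds everywhere. It is characterized in `Graphon.pushForward_spec`. -/
noncomputable def Graphon.pushForward {Ω Γ : Type*} [MeasurableSpace Ω] [MeasurableSpace Γ]
    {π : Measure Ω} (H : Graphon π) (φ : Ω → Γ) : Graphon (π.map φ) where
  W u v := min 1 (((H.pushDeriv φ (u, v)).toReal + (H.pushDeriv φ (v, u)).toReal) / 2)
  symm u v := by rw [add_comm]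
  bounded := ⟨1, fun u v => by
    rw [abs_le]
    refine ⟨?_, min_le_left _ _⟩
    have : (0 : ℝ) ≤ min 1 (((H.pushDeriv φ (u, v)).toReal + (H.pushDeriv φ (v, u)).toReal) / 2) :=
      le_min zero_le_one (by positivity)
    linarith⟩
  nullMeasurable := by
    have h : Measurable (H.pushDeriv φ) := Measure.measurable_rnDeriv _ _
    have h' : Measurable fun p : Γ × Γ => H.pushDeriv φ (p.2, p.1) := h.comp measurable_swap
    exact (measurable_const.min
      ((h.ennreal_toReal.add h'.ennreal_toReal).div_const 2)).nullMeasurable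

/-- The defining property of the push-forward: `W_φ` has the same integral over `A₁ × A₂` as `W` has
over `φ⁻¹ A₁ × φ⁻¹ A₂`. -/
theorem Graphon.pushForward_spec {Ω Γ : Type*} [MeasurableSpace Ω] [MeasurableSpace Γ]
    {π : Measure Ω} [IsProbabilityMeasure π] (H : Graphon π) (hH : H.UnitValued) {φ : Ω → Γ}
    (hφ : AEMeasurable φ π) {A₁ A₂ : Set Γ} (h₁ : MeasurableSet A₁) (h₂ : MeasurableSet A₂) :
    ∫ p in A₁ ×ˢ A₂, (H.pushForward φ).W p.1 p.2 ∂((π.map φ).prod (π.map φ)) =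
      ∫ p in (φ ⁻¹' A₁) ×ˢ (φ ⁻¹' A₂), H.W p.1 p.2 ∂(π.prod π) := by
  have hW : AEMeasurable (fun p : Ω × Ω => H.W p.1 p.2) (π.prod π) := H.nullMeasurable.aemeasurable
  set f : Ω × Ω → ℝ≥0∞ := fun p => ENNReal.ofReal (H.W p.1 p.2) with hf
  set P : Measure (Ω × Ω) := (π.prod π).withDensity f with hP
  have hPle : P ≤ π.prod π := by
    rw [← withDensity_one (μ := π.prod π)]
    refine withDensity_mono (Filter.Eventually.of_forall fun p => ?_)
    simpa [hf] using (hH p.1 p.2).2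
  have hPfin : IsFiniteMeasure P := isFiniteMeasure_of_le _ hPle
  have hψ : AEMeasurable (Prod.map φ φ) (π.prod π) :=
    (hφ.comp_fst (ν := π)).prodMk (hφ.comp_snd (μ := π))
  have hψP : AEMeasurable (Prod.map φ φ) P := hψ.mono_measure hPle
  have hQ : (π.map φ).prod (π.map φ) = (π.prod π).map (Prod.map φ φ) := by
    rw [Measure.map_congr hφ.ae_eq_mk, Measure.map_prod_map _ _ hφ.measurable_mk hφ.measurable_mk]
    refine Measure.map_congr ?_
    filter_upwards [Measure.quasiMeasurePreserving_fst.ae_eq_comp hφ.ae_eq_mk,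
      Measure.quasiMeasurePreserving_snd.ae_eq_comp hφ.ae_eq_mk] with p h h'
    exact Prod.ext h.symm h'.symm
  have := Measure.isProbabilityMeasure_map hφ
  set Q : Measure (Γ × Γ) := (π.map φ).prod (π.map φ) with hQdef
  set M : Measure (Γ × Γ) := P.map (Prod.map φ φ) with hM
  have hMle : M ≤ Q := by
    rw [hQ]
    refine Measure.le_iff.2 fun s hs => ?_
    rw [hM, Measure.map_apply_of_aemeasurable hψP hs, Measure.map_apply_of_aemeasurable hψ hs]
    exact hPle _
  have hMfin : IsFiniteMeasure M := isFiniteMeasure_of_le _ hMle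
  have hPswap : ∀ s : Set (Ω × Ω), P (Prod.swap ⁻¹' s) = P s := by
    intro s
    rw [hP, withDensity_apply', withDensity_apply',
      ← (Measure.measurePreserving_swap (μ := π) (ν := π)).setLIntegral_comp_preimage_emb
        MeasurableEquiv.prodComm.measurableEmbedding f s]
    refine lintegral_congr fun p => ?_
    simp only [hf, Prod.fst_swap, Prod.snd_swap, H.symm p.1 p.2]
  have hMswap : M.map Prod.swap = M := by
    ext s hs
    rw [Measure.map_apply measurable_swap hs, hM,
      Measure.map_apply_of_aemeasurable hψP (measurable_swap hs),
      Measure.map_apply_of_aemeasurable hψP hs, ← hPswap]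
    rfl
  have hQswap : Q.map Prod.swap = Q := Measure.prod_swap
  have hsymm : (fun p => H.pushDeriv φ p.swap) =ᵐ[Q] H.pushDeriv φ := by
    have h := (MeasurableEquiv.prodComm (α := Γ) (β := Γ)).measurableEmbedding.rnDeriv_map M Q
    have hc : ⇑(MeasurableEquiv.prodComm (α := Γ) (β := Γ)) = Prod.swap := rfl
    rw [hc, hMswap, hQswap] at h
    exact h
  have hle : H.pushDeriv φ ≤ᵐ[Q] 1 := Measure.rnDeriv_le_one_of_le hMle
  have hae : (fun p : Γ × Γ => (H.pushForward φ).W p.1 p.2) =ᵐ[Q]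
      fun p => (H.pushDeriv φ p).toReal := by
    filter_upwards [hsymm, hle] with p h h'
    have h1 : (H.pushDeriv φ p).toReal ≤ 1 :=
      ENNReal.toReal_le_of_le_ofReal zero_le_one (by simpa using h')
    have h2 : H.pushDeriv φ (p.2, p.1) = H.pushDeriv φ p := h
    change min 1 (((H.pushDeriv φ p).toReal + (H.pushDeriv φ (p.2, p.1)).toReal) / 2) = _
    rw [h2, add_self_div_two, min_eq_right h1]
  rw [integral_congr_ae (ae_restrict_of_ae hae),
    integral_eq_lintegral_of_nonneg_ae (f := fun p : Ω × Ω => H.W p.1 p.2)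
      (Filter.Eventually.of_forall fun p => (hH p.1 p.2).1)
      hW.aestronglyMeasurable.restrict]
  refine (Measure.setIntegral_toReal_rnDeriv (Measure.absolutelyContinuous_of_le hMle) _).trans ?_
  rw [Measure.real, hM, Measure.map_apply_of_aemeasurable hψP (h₁.prod h₂), hP, withDensity_apply']
  rfl

/-! ### Anchor sequences -/

/-- The tag `Φ_α(x) = (W(x, a_0), W(x, a_1), …) ∈ [0, 1]^ℕ`. -/
def Graphon.tag {Ω : Type*} [MeasurableSpace Ω] {π : Measure Ω} (H : Graphon π)
    (hH : H.UnitValued) (α : ℕ → Ω) (x : Ω) : ℕ → I :=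
  fun i => ⟨H.W x (α i), hH x (α i)⟩

/-- The tag distribution `λ_α`, the image of `π` under `Φ_α`, on the product `σ`-algebra of
`[0, 1]^ℕ`. -/
noncomputable def Graphon.tagMeasure {Ω : Type*} [MeasurableSpace Ω] {π : Measure Ω}
    (H : Graphon π) (hH : H.UnitValued) (α : ℕ → Ω) : Measure (ℕ → I) :=
  π.map (H.tag hH α)

/-- The graphon `W_α` on `([0, 1]^ℕ, λ_α)`, the push-forward of `W` under `Φ_α`. -/
noncomputable def Graphon.tagGraphon {Ω : Type*} [MeasurableSpace Ω] {π : Measure Ω}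
    (H : Graphon π) (hH : H.UnitValued) (α : ℕ → Ω) : Graphon (H.tagMeasure hH α) :=
  H.pushForward (H.tag hH α)

/-- `α` is regular: `Φ_α` is measurable (with respect to the completion of `π`), so that `λ_α` and
`W_α` are defined, and `W(x, y) = W_α(Φ_α(x), Φ_α(y))` for almost all `(x, y)`. -/
def Graphon.IsRegular {Ω : Type*} [MeasurableSpace Ω] {π : Measure Ω}
    (H : Graphon π) (hH : H.UnitValued) (α : ℕ → Ω) : Prop :=
  NullMeasurable (H.tag hH α) π ∧
    ∀ᵐ p ∂(π.prod π), H.W p.1 p.2 = (H.tagGraphon hH α).W (H.tag hH α p.1) (H.tag hH α p.2)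

/-! ### Couplings -/

/-- `γ` is a coupling of `(X, μ)` and `(Y, ν)`: a measure on the product with marginals `μ`, `ν`. -/
def IsCoupling {X Y : Type*} [MeasurableSpace X] [MeasurableSpace Y]
    (μ : Measure X) (ν : Measure Y) (γ : Measure (X × Y)) : Prop :=
  γ.map Prod.fst = μ ∧ γ.map Prod.snd = ν

/-!
Gluing along the labeled nodes multiplies the densities `t_α(F, H)`, and averaging over `α` turns
them into ordinary densities. So the mixed moments of the random family `(t_α(F, H))_F` are
densities of multigraphs; if `H` and `H'` have the same densities, then these bounded families have
the same moments, hence the same law. Two random elements with the same law can be coupled so that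
they agree almost surely as soon as one of them lives on the image of a standard Borel space: lift
it to that space and disintegrate.

For the second part, the moments of `(Φ_α(x), Φ_α(y), W(x, y))` are the densities `t_α(F, H)` of
graphs with two unlabeled nodes, so these densities determine the joint law. Regularity says that
under this law the third coordinate is `W_α` of the first two.
-/

/-! ### Lebesgue spaces as images of standard Borel spaces -/

/-- `π` is the image of a standard Borel probability space under a map which is measurable with
respect to the completion. This is what the coupling argument uses of a Lebesgue space. Taking the
standard Borel space in `Type` is no restriction: each one is isomorphic to a subset of `ℝ`. -/
def IsStandardBorelImage {Ω : Type*} [MeasurableSpace Ω] (π : Measure Ω) : Prop :=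
  ∃ (R : Type) (_ : MeasurableSpace R) (_ : StandardBorelSpace R) (ρ : Measure R)
    (_ : IsProbabilityMeasure ρ) (ψ : NullMeasurableSpace R ρ → Ω),
    MeasurePreserving ψ ρ.completion π

theorem IsIsoModZero.exists_measurePreserving_inverse {α β : Type*} [MeasurableSpace α]
    [MeasurableSpace β] [Nonempty α] {μ : Measure α} {ν : Measure β} {φ : α → β}
    (h : IsIsoModZero μ ν φ) : ∃ ψ : β → α, MeasurePreserving ψ ν μ ∧ ψ ∘ φ =ᵐ[μ] id := by
  classical
  obtain ⟨hφ, N, N', -, hN, hN', -, e, he, -⟩ := h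
  let ψ : β → α := fun y => if hy : y ∈ N' then Classical.arbitrary α else e.symm ⟨y, hy⟩
  have hψ : Measurable ψ :=
    Measurable.dite (s := N') measurable_const
      (measurable_subtype_coe.comp e.symm.measurable) hN'
  have hinv : ψ ∘ φ =ᵐ[μ] id := by
    filter_upwards [compl_mem_ae_iff.2 hN] with x hx
    have hφx : φ x ∉ N' := he ⟨x, hx⟩ ▸ (e ⟨x, hx⟩).2
    have hex : e.symm ⟨φ x, hφx⟩ = ⟨x, hx⟩ :=
      e.symm_apply_eq.2 (Subtype.ext (he ⟨x, hx⟩).symm)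
    simp only [Function.comp_apply, ψ, dif_neg hφx, hex, id]
  refine ⟨ψ, ⟨hψ, ?_⟩, hinv⟩
  rw [← hφ.map_eq, Measure.map_map hψ hφ.measurable, Measure.map_congr hinv, Measure.map_id]

instance borelSpace_sum {α β : Type*} [TopologicalSpace α] [MeasurableSpace α] [BorelSpace α]
    [TopologicalSpace β] [MeasurableSpace β] [BorelSpace β] : BorelSpace (α ⊕ β) := by
  refine ⟨le_antisymm (fun s hs => ?_) (MeasurableSpace.generateFrom_le fun s hs => ?_)⟩
  · obtain ⟨hinl, hinr⟩ := measurableSet_sum_iff.1 hs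
    borelize (α ⊕ β)
    rw [← Set.image_preimage_inl_union_image_preimage_inr s]
    exact (Topology.IsOpenEmbedding.inl.measurableEmbedding.measurableSet_image.2 hinl).union
      (Topology.IsOpenEmbedding.inr.measurableEmbedding.measurableSet_image.2 hinr)
  · obtain ⟨hinl, hinr⟩ := isOpen_sum_iff.1 hs
    exact measurableSet_sum_iff.2 ⟨hinl.measurableSet, hinr.measurableSet⟩

theorem IsLebesgueSpace.isStandardBorelImage {Ω : Type*} [MeasurableSpace Ω] {π : Measure Ω}
    (h : IsLebesgueSpace π) : IsStandardBorelImage π := by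
  obtain ⟨_, -, a, b, S, w, -, -, φ, hφ⟩ := h
  have : Nonempty Ω := nonempty_of_isProbabilityMeasure π
  have hprob : IsProbabilityMeasure (intervalAtoms a b S w).completion :=
    hφ.1.map_eq ▸ Measure.isProbabilityMeasure_map hφ.1.aemeasurable
  have : IsProbabilityMeasure (intervalAtoms a b S w) :=
    ⟨(Measure.completion_apply _ _).symm.trans hprob.measure_univ⟩
  obtain ⟨ψ, hψ, -⟩ := hφ.exists_measurePreserving_inverse
  exact ⟨_, inferInstance, inferInstance, intervalAtoms a b S w, inferInstance, ψ, hψ⟩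

theorem measurePreserving_completion_iff {α β : Type*} [MeasurableSpace α] [MeasurableSpace β]
    {μ : Measure α} {ν : Measure β} {f : α → β} :
    MeasurePreserving (α := NullMeasurableSpace α μ) f μ.completion ν ↔
      NullMeasurable f μ ∧ ∀ s, MeasurableSet s → μ (f ⁻¹' s) = ν s := by
  have hmap (hf : NullMeasurable f μ) {s : Set β} (hs : MeasurableSet s) :
      Measure.map (α := NullMeasurableSpace α μ) f μ.completion s = μ (f ⁻¹' s) :=
    (Measure.map_apply (α := NullMeasurableSpace α μ) hf hs).trans (Measure.completion_apply _ _)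
  refine ⟨fun hf => ⟨hf.measurable, fun s hs => ?_⟩, fun hf => ⟨hf.1, Measure.ext fun s hs => ?_⟩⟩
  · rw [← hmap hf.measurable hs, hf.map_eq]
  · rw [hmap hf.1 hs, hf.2 s hs]

theorem measurePreserving_completion_completion {α β : Type*} [MeasurableSpace α]
    [MeasurableSpace β] {μ : Measure α} {ν : Measure β} {f : α → β} (hf : MeasurePreserving f μ ν) :
    MeasurePreserving (α := NullMeasurableSpace α μ) (β := NullMeasurableSpace β ν) f
      μ.completion ν.completion :=
  measurePreserving_completion_iff.2
    ⟨fun _ hs => NullMeasurableSet.preimage hs hf.quasiMeasurePreserving,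
      fun s hs => (hf.measure_preimage (s := s) hs).trans (Measure.completion_apply ν s).symm⟩

theorem infinitePi_pi₀ {ι : Type*} {X : ι → Type*} [∀ i, MeasurableSpace (X i)]
    (μ : ∀ i, Measure (X i)) [∀ i, IsProbabilityMeasure (μ i)] {s : Finset ι}
    {t : ∀ i, Set (X i)} (ht : ∀ i ∈ s, NullMeasurableSet (t i) (μ i)) :
    Measure.infinitePi μ (Set.pi s t) = ∏ i ∈ s, μ i (t i) := by
  have hae : ∀ i ∈ s, ∀ᵐ x ∂Measure.infinitePi μ, x i ∈ toMeasurable (μ i) (t i) ↔ x i ∈ t i :=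
    fun i hi => (measurePreserving_eval_infinitePi μ i).quasiMeasurePreserving.ae
      ((ht i hi).toMeasurable_ae_eq.mono fun _ => iff_of_eq)
  calc Measure.infinitePi μ (Set.pi s t)
    _ = Measure.infinitePi μ (Set.pi s fun i => toMeasurable (μ i) (t i)) := by
      refine measure_congr ?_
      filter_upwards [(Finset.eventually_all s).2 hae] with x hx
      exact propext (forall₂_congr fun i hi => (hx i hi).symm)
    _ = ∏ i ∈ s, μ i (t i) := by
      simp only [Measure.infinitePi_pi _ fun _ _ => measurableSet_toMeasurable _ _,
        measure_toMeasurable]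

theorem measurePreserving_infinitePi_completion {ι : Type*} {R Ω : ι → Type*}
    [∀ i, MeasurableSpace (R i)] [∀ i, MeasurableSpace (Ω i)] {ρ : ∀ i, Measure (R i)}
    {π : ∀ i, Measure (Ω i)} [∀ i, IsProbabilityMeasure (ρ i)] [∀ i, IsProbabilityMeasure (π i)]
    {ψ : ∀ i, NullMeasurableSpace (R i) (ρ i) → Ω i}
    (hψ : ∀ i, MeasurePreserving (ψ i) (ρ i).completion (π i)) :
    MeasurePreserving (α := NullMeasurableSpace (∀ i, R i) (Measure.infinitePi ρ))
      (fun r i => ψ i (r i)) (Measure.infinitePi ρ).completion (Measure.infinitePi π) := by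
  set P := Measure.infinitePi ρ
  let Ψ : NullMeasurableSpace (∀ i, R i) P → ∀ i, Ω i := fun r i => ψ i (r i)
  have hΨ : Measurable Ψ := measurable_pi_iff.2 fun i => (hψ i).measurable.comp
    (measurePreserving_completion_completion (measurePreserving_eval_infinitePi ρ i)).measurable
  refine ⟨hΨ, Measure.eq_infinitePi _ fun s t ht => ?_⟩
  calc P.completion.map Ψ (Set.pi s t)
    _ = P (Set.pi s fun i => ψ i ⁻¹' t i) :=
      (Measure.map_apply hΨ (MeasurableSet.pi s.countable_toSet fun i _ => ht i)).trans
        (Measure.completion_apply _ _)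
    _ = ∏ i ∈ s, ρ i (ψ i ⁻¹' t i) := infinitePi_pi₀ ρ fun i _ => (hψ i).measurable (ht i)
    _ = ∏ i ∈ s, π i (t i) := Finset.prod_congr rfl fun i _ =>
      (measurePreserving_completion_iff (α := R i) |>.1 (hψ i)).2 _ (ht i)

theorem IsStandardBorelImage.infinitePi {ι : Type} [Countable ι] {Ω : ι → Type*}
    [∀ i, MeasurableSpace (Ω i)] {π : ∀ i, Measure (Ω i)} [∀ i, IsProbabilityMeasure (π i)]
    (h : ∀ i, IsStandardBorelImage (π i)) : IsStandardBorelImage (Measure.infinitePi π) := by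
  choose R _ _ ρ _ ψ hψ using h
  exact ⟨∀ i, R i, inferInstance, inferInstance, Measure.infinitePi ρ, inferInstance,
    fun r i => ψ i (r i), measurePreserving_infinitePi_completion hψ⟩

/-! ### Coupling random elements with equal laws -/

section Coupling

variable {M R Ω' X : Type*} [MeasurableSpace M] [MeasurableSpace R] [MeasurableSpace Ω']
  [MeasurableSpace X] {μ : Measure M} {ρ : Measure R} {ν : Measure Ω'}

theorem IsCoupling.measurePreserving_fst {γ : Measure (M × R)} (h : IsCoupling μ ρ γ) :
    MeasurePreserving Prod.fst γ μ :=
  ⟨measurable_fst, h.1⟩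

theorem IsCoupling.measurePreserving_snd {γ : Measure (M × R)} (h : IsCoupling μ ρ γ) :
    MeasurePreserving Prod.snd γ ρ :=
  ⟨measurable_snd, h.2⟩

open ProbabilityTheory in
theorem exists_isCoupling_ae_eq_of_measurable [StandardBorelSpace R] [MeasurableEq X]
    [IsProbabilityMeasure μ] [IsProbabilityMeasure ρ] {T : M → X} {S : R → X}
    (hT : Measurable T) (hS : Measurable S) (h : μ.map T = ρ.map S) :
    ∃ γ, IsCoupling μ ρ γ ∧ ∀ᵐ p ∂γ, T p.1 = S p.2 := by
  have : Nonempty R := nonempty_of_isProbabilityMeasure ρ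
  let κ : Kernel X R := condDistrib id S ρ
  let γ : Measure (M × R) := μ ⊗ₘ κ.comap T hT
  have hjoint : γ.map (Prod.map T id) = ρ.map fun r => (S r, r) :=
    calc γ.map (Prod.map T id)
      _ = μ.map T ⊗ₘ κ := by
        ext A hA
        rw [Measure.map_apply (hT.prodMap measurable_id) hA,
          Measure.compProd_apply (hT.prodMap measurable_id hA), Measure.compProd_apply hA,
          lintegral_map (Kernel.measurable_kernel_prodMk_left hA) hT]
        rfl
      _ = ρ.map fun r => (S r, r) := by rw [h]; exact compProd_map_condDistrib aemeasurable_id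
  have hsnd : γ.map Prod.snd = ρ :=
    calc γ.map Prod.snd
      _ = (γ.map (Prod.map T id)).map Prod.snd :=
        (Measure.map_map measurable_snd (hT.prodMap measurable_id)).symm
      _ = ρ := by
        rw [hjoint, Measure.map_map measurable_snd (hS.prodMk measurable_id')]
        exact Measure.map_id
  refine ⟨γ, ⟨Measure.fst_compProd μ _, hsnd⟩, ?_⟩
  have hgraph : ∀ᵐ z ∂γ.map (Prod.map T id), z.1 = S z.2 := by
    have hset : MeasurableSet {z : X × R | z.1 = S z.2} :=
      measurableSet_eq_fun measurable_fst (hS.comp measurable_snd)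
    rw [hjoint, ae_map_iff (hS.prodMk measurable_id').aemeasurable hset]
    exact .of_forall fun _ => rfl
  exact ae_of_ae_map (hT.prodMap measurable_id).aemeasurable hgraph

theorem exists_isCoupling_ae_eq_of_standardBorel [StandardBorelSpace R] [MeasurableEq X]
    [IsProbabilityMeasure μ] [IsProbabilityMeasure ρ] {T : M → X} {S : R → X}
    (hT : AEMeasurable T μ) (hS : AEMeasurable S ρ) (h : μ.map T = ρ.map S) :
    ∃ γ, IsCoupling μ ρ γ ∧ ∀ᵐ p ∂γ, T p.1 = S p.2 := by
  rw [Measure.map_congr hT.ae_eq_mk, Measure.map_congr hS.ae_eq_mk] at h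
  obtain ⟨γ, hγ, heq⟩ :=
    exists_isCoupling_ae_eq_of_measurable hT.measurable_mk hS.measurable_mk h
  refine ⟨γ, hγ, ?_⟩
  filter_upwards [heq, hγ.measurePreserving_fst.quasiMeasurePreserving.ae hT.ae_eq_mk,
    hγ.measurePreserving_snd.quasiMeasurePreserving.ae hS.ae_eq_mk] with p hp hpT hpS
  rw [hpT, hp, ← hpS]

theorem IsCoupling.exists_measurePreserving_prodMap {γ : Measure (M × R)} (hγ : IsCoupling μ ρ γ)
    {ψ : NullMeasurableSpace R ρ → Ω'} (hψ : MeasurePreserving ψ ρ.completion ν) :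
    ∃ γ' : Measure (M × Ω'), IsCoupling μ ν γ' ∧
      MeasurePreserving (α := NullMeasurableSpace (M × R) γ) (Prod.map id ψ) γ.completion γ' := by
  have hfst : MeasurePreserving (α := NullMeasurableSpace (M × R) γ) Prod.fst γ.completion μ :=
    measurePreserving_completion_iff.2 ⟨measurable_fst.nullMeasurable,
      fun s hs => hγ.measurePreserving_fst.measure_preimage hs.nullMeasurableSet⟩
  have hsnd : MeasurePreserving (α := NullMeasurableSpace (M × R) γ) (ψ ∘ Prod.snd)
      γ.completion ν :=
    hψ.comp (measurePreserving_completion_completion hγ.measurePreserving_snd)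
  have hψγ : Measurable[NullMeasurableSpace.instMeasurableSpace (μ := γ)] (Prod.map id ψ) :=
    hfst.measurable.prodMk hsnd.measurable
  exact ⟨_, ⟨(Measure.map_map measurable_fst hψγ).trans hfst.map_eq,
    (Measure.map_map measurable_snd hψγ).trans hsnd.map_eq⟩, hψγ, rfl⟩

theorem aemeasurable_comp_of_measurePreserving_completion [MeasurableSpace.CountablyGenerated X]
    {ψ : NullMeasurableSpace R ρ → Ω'} (hψ : MeasurePreserving ψ ρ.completion ν) {T : Ω' → X}
    (hT : AEMeasurable T ν) : AEMeasurable (T ∘ ψ : R → X) ρ := by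
  have hmk : NullMeasurable (hT.mk T ∘ ψ : R → X) ρ := hT.measurable_mk.comp hψ.measurable
  exact hmk.aemeasurable.congr (hψ.quasiMeasurePreserving.ae_eq_comp hT.ae_eq_mk).symm

theorem map_comp_of_measurePreserving_completion [MeasurableSpace.CountablyGenerated X]
    {ψ : NullMeasurableSpace R ρ → Ω'} (hψ : MeasurePreserving ψ ρ.completion ν) {T : Ω' → X}
    (hT : AEMeasurable T ν) : ρ.map (T ∘ ψ : R → X) = ν.map T := by
  ext A hA
  rw [Measure.map_apply_of_aemeasurable
      (aemeasurable_comp_of_measurePreserving_completion hψ hT) hA,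
    Measure.map_apply_of_aemeasurable hT hA,
    ← hψ.measure_preimage (hT.nullMeasurableSet_preimage hA)]
  exact (Measure.completion_apply _ _).symm

theorem IsStandardBorelImage.exists_isCoupling_ae_eq [MeasurableEq X]
    [MeasurableSpace.CountablyGenerated X] [IsProbabilityMeasure μ] (hν : IsStandardBorelImage ν)
    {T : M → X} {T' : Ω' → X} (hT : AEMeasurable T μ) (hT' : AEMeasurable T' ν)
    (h : μ.map T = ν.map T') : ∃ γ, IsCoupling μ ν γ ∧ ∀ᵐ p ∂γ, T p.1 = T' p.2 := by
  obtain ⟨R, _, _, ρ, _, ψ, hψ⟩ := hν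
  obtain ⟨γ₀, hγ₀, heq⟩ := exists_isCoupling_ae_eq_of_standardBorel hT
    (aemeasurable_comp_of_measurePreserving_completion hψ hT')
    (h.trans (map_comp_of_measurePreserving_completion hψ hT').symm)
  obtain ⟨γ, hγ, hψγ⟩ := hγ₀.exists_measurePreserving_prodMap hψ
  have hset : NullMeasurableSet {p : M × Ω' | T p.1 = T' p.2}ᶜ γ :=
    (nullMeasurableSet_eq_fun
      (hT.comp_quasiMeasurePreserving hγ.measurePreserving_fst.quasiMeasurePreserving)
      (hT'.comp_quasiMeasurePreserving hγ.measurePreserving_snd.quasiMeasurePreserving)).compl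
  exact ⟨γ, hγ, (hψγ.measure_preimage hset).symm.trans heq⟩

end Coupling

/-! ### Laws determined by moments -/

section Moments

open scoped BoundedContinuousFunction

variable {X ι : Type*} [TopologicalSpace X] [MeasurableSpace X]

theorem integral_eq_of_mem_adjoin_range [OpensMeasurableSpace X] {P Q : Measure X}
    [IsFiniteMeasure P] [IsFiniteMeasure Q] {g : ι → X →ᵇ ℝ}
    (h : ∀ m : Multiset ι, ∫ x, (m.map g).prod x ∂P = ∫ x, (m.map g).prod x ∂Q) {a : X →ᵇ ℝ}
    (ha : a ∈ Algebra.adjoin ℝ (Set.range g)) : ∫ x, a x ∂P = ∫ x, a x ∂Q := by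
  rw [← Subalgebra.mem_toSubmodule, Algebra.adjoin_eq_span] at ha
  induction ha using Submodule.span_induction with
  | mem b hb =>
    obtain ⟨l, hl, rfl⟩ := Submonoid.exists_multiset_of_mem_closure hb
    have : CanLift (X →ᵇ ℝ) ι g (· ∈ Set.range g) := ⟨fun _ hb => hb⟩
    lift l to Multiset ι using hl
    exact h l
  | zero => simp only [BoundedContinuousFunction.coe_zero, Pi.zero_apply, integral_zero]
  | add b c _ _ hb hc =>
    simp only [BoundedContinuousFunction.coe_add, Pi.add_apply]
    rw [integral_add (b.integrable P) (c.integrable P), integral_add (b.integrable Q)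
      (c.integrable Q), hb, hc]
  | smul r b _ hb =>
    simp only [BoundedContinuousFunction.coe_smul, integral_smul, hb]

theorem ext_of_forall_integral_multiset_prod_eq [PolishSpace X] [CompactSpace X] [BorelSpace X]
    {P Q : Measure X} [IsFiniteMeasure P] [IsFiniteMeasure Q] (f : ι → C(X, ℝ))
    (hf : ∀ x y, (∀ i, f i x = f i y) → x = y)
    (h : ∀ m : Multiset ι, ∫ x, (m.map fun i => f i x).prod ∂P =
      ∫ x, (m.map fun i => f i x).prod ∂Q) : P = Q := by
  let g : ι → X →ᵇ ℝ := fun i => .mkOfCompact (f i)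
  have hg (m : Multiset ι) (x : X) : (m.map g).prod x = (m.map fun i => f i x).prod :=
    (map_multiset_prod ((Pi.evalMonoidHom (fun _ => ℝ) x).comp
      BoundedContinuousFunction.coeFnMonoidHom) (m.map g)).trans
        (congrArg Multiset.prod (Multiset.map_map _ _ _))
  let A : StarSubalgebra ℝ (X →ᵇ ℝ) :=
    { Algebra.adjoin ℝ (Set.range g) with star_mem' := fun {_} ha => ha }
  refine ext_of_forall_mem_subalgebra_integral_eq_of_polish (𝕜 := ℝ) (A := A) ?_ fun a ha => ?_
  · intro x y hxy
    obtain ⟨i, hi⟩ := not_forall.1 (mt (hf x y) hxy)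
    exact ⟨_, ⟨_, ⟨g i, Algebra.subset_adjoin ⟨i, rfl⟩, rfl⟩, rfl⟩, hi⟩
  · exact integral_eq_of_mem_adjoin_range (fun m => by simpa only [hg] using h m) ha

theorem map_eq_map_of_integral_multiset_prod_eq [PolishSpace X] [CompactSpace X] [BorelSpace X]
    {M M' : Type*} [MeasurableSpace M] [MeasurableSpace M'] {μ : Measure M} {μ' : Measure M'}
    [IsFiniteMeasure μ] [IsFiniteMeasure μ'] {T : M → X} {T' : M' → X} (hT : AEMeasurable T μ)
    (hT' : AEMeasurable T' μ') (f : ι → C(X, ℝ)) (hf : ∀ x y, (∀ i, f i x = f i y) → x = y)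
    (h : ∀ m : Multiset ι, ∫ ω, (m.map fun i => f i (T ω)).prod ∂μ =
      ∫ ω, (m.map fun i => f i (T' ω)).prod ∂μ') : μ.map T = μ'.map T' := by
  refine ext_of_forall_integral_multiset_prod_eq f hf fun m => ?_
  have hm : Continuous fun x => (m.map fun i => f i x).prod :=
    continuous_multiset_prod m fun i _ => (f i).continuous
  rw [integral_map hT hm.aestronglyMeasurable, integral_map hT' hm.aestronglyMeasurable, h]

end Moments

/-! ### Densities on infinite node sets and gluing -/

theorem measurePreserving_comp_infinitePi {V V' : Type*} {Ω : V → Type*}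
    [∀ v, MeasurableSpace (Ω v)] (π : ∀ v, Measure (Ω v)) [∀ v, IsProbabilityMeasure (π v)]
    {ι : V' → V} (hι : ι.Injective) :
    MeasurePreserving (fun (x : ∀ v, Ω v) v => x (ι v)) (Measure.infinitePi π)
      (Measure.infinitePi fun v => π (ι v)) :=
  ⟨by fun_prop, Measure.map_infinitePi_infinitePi_of_inj hι⟩

theorem measurePreserving_sumPiEquivProdPi_symm_infinitePi {U V : Type*} {Ω : U ⊕ V → Type*}
    [∀ v, MeasurableSpace (Ω v)] (π : ∀ v, Measure (Ω v)) [∀ v, IsProbabilityMeasure (π v)] :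
    MeasurePreserving (MeasurableEquiv.sumPiEquivProdPi Ω).symm
      ((Measure.infinitePi fun u => π (.inl u)).prod (Measure.infinitePi fun v => π (.inr v)))
      (Measure.infinitePi π) := by
  refine ⟨(MeasurableEquiv.sumPiEquivProdPi Ω).symm.measurable,
    Measure.eq_infinitePi _ fun s t ht => ?_⟩
  have hpre : (MeasurableEquiv.sumPiEquivProdPi Ω).symm ⁻¹' Set.pi s t =
      (Set.pi s.toLeft fun u => t (.inl u)) ×ˢ (Set.pi s.toRight fun v => t (.inr v)) := by
    ext p
    simp only [Set.mem_preimage, Set.mem_prod, Set.mem_pi, Finset.mem_coe, Finset.mem_toLeft,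
      Finset.mem_toRight, Sum.forall]
    rfl
  rw [MeasurableEquiv.map_apply, hpre, Measure.prod_prod, Measure.infinitePi_pi _ fun _ _ => ht _,
    Measure.infinitePi_pi _ fun _ _ => ht _, Finset.prod_sum_eq_prod_toLeft_mul_prod_toRight]

theorem integral_comp_of_measurePreserving {α β E : Type*} [MeasurableSpace α] [MeasurableSpace β]
    [NormedAddCommGroup E] [NormedSpace ℝ E] {μ : Measure α} {ν : Measure β} {f : α → β} {g : β → E}
    (hf : MeasurePreserving f μ ν) (hg : AEStronglyMeasurable g ν) :
    ∫ x, g (f x) ∂μ = ∫ y, g y ∂ν := by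
  rw [← hf.map_eq] at hg ⊢
  exact (integral_map hf.measurable.aemeasurable hg).symm

theorem measurePreserving_eval_pair_infinitePi {V Ω : Type*} [MeasurableSpace Ω] (π : Measure Ω)
    [IsProbabilityMeasure π] {a b : V} (h : a ≠ b) :
    MeasurePreserving (fun x : V → Ω => (x a, x b)) (Measure.infinitePi fun _ : V => π)
      (π.prod π) :=
  ⟨by fun_prop, Measure.infinitePi_map_eval_prod h⟩

namespace Multigraph

universe u

variable {U V V' : Type*}

/-- The image of a multigraph under an injective map of nodes; injectivity rules out loops. -/
def map (F : Multigraph V) (ι : V ↪ V') : Multigraph V' where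
  edges := F.edges.map (Sym2.map ι)
  loopless := by
    intro e he
    obtain ⟨e, he', rfl⟩ := Multiset.mem_map.1 he
    rw [Sym2.isDiag_map ι.injective]
    exact F.loopless e he'

/-- The union of two multigraphs on the same nodes, adding multiplicities. -/
def union (F G : Multigraph V) : Multigraph V where
  edges := F.edges + G.edges
  loopless := fun e he => (Multiset.mem_add.1 he).elim (F.loopless e) (G.loopless e)

/-- The gluing product of two multigraphs with common labeled nodes `U`: the disjoint union, with
the nodes in `U` identified. -/
def glue (F : Multigraph (U ⊕ V)) (G : Multigraph (U ⊕ V')) : Multigraph (U ⊕ (V ⊕ V')) :=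
  (F.map ((Function.Embedding.refl U).sumMap .inl)).union
    (G.map ((Function.Embedding.refl U).sumMap .inr))

/-- The gluing product of a list of multigraphs with common labeled nodes `U`, together with its set
of unlabeled nodes. -/
def glueList {ι : Type*} {V : ι → Type u} (F : ∀ i, Multigraph (U ⊕ V i)) :
    List ι → Σ V' : Type u, Multigraph (U ⊕ V')
  | [] => ⟨PEmpty, ⟨0, fun _ he => absurd he (Multiset.notMem_zero _)⟩⟩
  | i :: l => ⟨V i ⊕ (glueList F l).1, (F i).glue (glueList F l).2⟩

theorem exists_map_eq (ι : V' ↪ V) (F : Multigraph V)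
    (h : ∀ e ∈ F.edges, ∀ v ∈ e, v ∈ Set.range ι) : ∃ F' : Multigraph V', F'.map ι = F := by
  obtain ⟨edges, loopless⟩ := F
  have hrange : ∀ e ∈ edges, e ∈ Set.range (Sym2.map ι) := by
    intro e he
    induction e with
    | _ a b =>
      obtain ⟨a', rfl⟩ := h _ he a (Sym2.mem_mk_left _ _)
      obtain ⟨b', rfl⟩ := h _ he b (Sym2.mem_mk_right _ _)
      exact ⟨s(a', b'), rfl⟩
  have : CanLift (Sym2 V) (Sym2 V') (Sym2.map ι) (· ∈ Set.range (Sym2.map ι)) := ⟨fun _ he => he⟩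
  lift edges to Multiset (Sym2 V') using hrange
  refine ⟨⟨edges, fun e he => ?_⟩, rfl⟩
  rw [← Sym2.isDiag_map ι.injective]
  exact loopless _ (Multiset.mem_map_of_mem _ he)

theorem exists_finset_support (F : Multigraph V) :
    ∃ t : Finset V, ∀ e ∈ F.edges, ∀ v ∈ e, v ∈ t := by
  classical
  exact ⟨F.edges.toFinset.biUnion Sym2.toFinset, fun e he v hv =>
    Finset.mem_biUnion.2 ⟨e, Multiset.mem_toFinset.2 he, Sym2.mem_toFinset.2 hv⟩⟩

instance instCountable [Countable V] : Countable (Multigraph V) := by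
  have : Countable (Sym2 V) := Quot.mk_surjective.countable
  exact Function.Injective.countable (f := edges) fun ⟨_, _⟩ ⟨_, _⟩ h => by cases h; rfl

end Multigraph

namespace PartiallyLabeledMultigraph

instance instCountable : Countable PartiallyLabeledMultigraph := by
  have hlabel (r : ℕ) : Countable (Fin r ↪ ℕ) := DFunLike.coe_injective.countable
  refine Function.Injective.countable
    (f := fun F => (⟨F.r, F.s, F.label, F.graph⟩ :
      Σ (r : ℕ) (s : ℕ), (Fin r ↪ ℕ) × Multigraph (Fin r ⊕ Fin s))) ?_
  rintro ⟨r, s, label, graph⟩ ⟨r', s', label', graph'⟩ h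
  cases h
  rfl

/-- A partially labeled multigraph as a multigraph whose labeled nodes are all natural numbers,
each of them being its own label. Labels which do not occur become isolated nodes. -/
def toMultigraph (F : PartiallyLabeledMultigraph) : Multigraph (ℕ ⊕ Fin F.s) :=
  F.graph.map (F.label.sumMap (.refl _))

end PartiallyLabeledMultigraph

namespace Graphon

variable {Ω Ω' : Type*} [MeasurableSpace Ω] [MeasurableSpace Ω'] {π : Measure Ω} {π' : Measure Ω'}
  {U V V' : Type*}

theorem edgeProd_map (H : Graphon π) (F : Multigraph V) (ι : V ↪ V') (x : V' → Ω) :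
    H.edgeProd (F.map ι) x = H.edgeProd F fun v => x (ι v) := by
  simp only [edgeProd, Multigraph.map, Multiset.map_map]
  congr 2
  funext e
  induction e with
  | _ a b => rfl

theorem edgeProd_union (H : Graphon π) (F G : Multigraph V) (x : V → Ω) :
    H.edgeProd (F.union G) x = H.edgeProd F x * H.edgeProd G x := by
  simp only [edgeProd, Multigraph.union, Multiset.map_add, Multiset.prod_add]

theorem abs_edgeProd_le (H : Graphon π) {C : ℝ} (hW : ∀ x y, |H.W x y| ≤ C) (F : Multigraph V)
    (x : V → Ω) : |H.edgeProd F x| ≤ C ^ Multiset.card F.edges := by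
  have hedge (e : Sym2 V) : |H.edgeValue x e| ≤ C := by
    induction e with
    | _ a b => exact hW _ _
  rw [edgeProd]
  induction F.edges using Multiset.induction_on with
  | empty => simp
  | cons e m ih =>
    rw [Multiset.map_cons, Multiset.prod_cons, Multiset.card_cons, pow_succ', abs_mul]
    exact mul_le_mul (hedge e) ih (abs_nonneg _) ((abs_nonneg _).trans (hedge e))

/-- The density of a multigraph whose nodes in `U` are mapped to the points `α u`, while the other
nodes, of which there may be infinitely many, are mapped to independent points. -/
noncomputable def rootedDensity (H : Graphon π) (α : U → Ω) (G : Multigraph (U ⊕ V)) : ℝ :=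
  ∫ x, H.edgeProd G (Sum.elim α x) ∂(Measure.infinitePi fun _ : V => π)

theorem rootedDensity_map_sumMap (H : Graphon π) (α : U → Ω) {U' : Type*} (ι : U' ↪ U)
    (F : Multigraph (U' ⊕ V)) :
    H.rootedDensity α (F.map (ι.sumMap (.refl V))) = H.rootedDensity (α ∘ ι) F := by
  simp only [rootedDensity, edgeProd_map]
  congr! 3 with x
  funext v
  cases v <;> rfl

variable [IsProbabilityMeasure π] [IsProbabilityMeasure π'] (H : Graphon π)

theorem aestronglyMeasurable_edgeValue {e : Sym2 V} (he : ¬ e.IsDiag) :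
    AEStronglyMeasurable (fun x => H.edgeValue x e) (Measure.infinitePi fun _ : V => π) := by
  induction e with
  | _ a b =>
    exact H.nullMeasurable.aemeasurable.aestronglyMeasurable.comp_measurePreserving
      (measurePreserving_eval_pair_infinitePi π he)

theorem aestronglyMeasurable_edgeProd (F : Multigraph V) :
    AEStronglyMeasurable (H.edgeProd F) (Measure.infinitePi fun _ : V => π) := by
  have hedge : ∀ e ∈ F.edges, AEStronglyMeasurable (fun x => H.edgeValue x e)
      (Measure.infinitePi fun _ : V => π) :=
    fun e he => H.aestronglyMeasurable_edgeValue (F.loopless e he)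
  change AEStronglyMeasurable (fun x => (F.edges.map (H.edgeValue x)).prod) _
  generalize F.edges = edges at hedge ⊢
  induction edges using Multiset.induction_on with
  | empty => simpa only [Multiset.map_zero, Multiset.prod_zero] using aestronglyMeasurable_const
  | cons e m ih =>
    simp only [Multiset.map_cons, Multiset.prod_cons]
    exact (hedge e (Multiset.mem_cons_self e m)).mul
      (ih fun e he => hedge e (Multiset.mem_cons_of_mem he))

theorem integrable_edgeProd (F : Multigraph V) :
    Integrable (H.edgeProd F) (Measure.infinitePi fun _ : V => π) := by
  obtain ⟨C, hC⟩ := H.bounded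
  exact .of_bound (H.aestronglyMeasurable_edgeProd F) _ (.of_forall (H.abs_edgeProd_le hC F))

theorem integral_edgeProd_map (F : Multigraph V) (ι : V ↪ V') :
    ∫ x, H.edgeProd (F.map ι) x ∂(Measure.infinitePi fun _ : V' => π) =
      ∫ x, H.edgeProd F x ∂(Measure.infinitePi fun _ : V => π) := by
  simp only [edgeProd_map]
  exact integral_comp_of_measurePreserving
    (measurePreserving_comp_infinitePi (fun _ => π) ι.injective) (H.aestronglyMeasurable_edgeProd F)

variable {H} {H' : Graphon π'}

theorem integral_edgeProd_eq_of_density_eq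
    (h : ∀ (k : ℕ) (F : Multigraph (Fin k)), H.density F = H'.density F) (F : Multigraph V) :
    ∫ x, H.edgeProd F x ∂(Measure.infinitePi fun _ : V => π) =
      ∫ x, H'.edgeProd F x ∂(Measure.infinitePi fun _ : V => π') := by
  obtain ⟨t, ht⟩ := F.exists_finset_support
  let ι : Fin t.card ↪ V := t.equivFin.symm.toEmbedding.trans (.subtype _)
  obtain ⟨F, rfl⟩ := Multigraph.exists_map_eq ι F fun e he v hv =>
    ⟨t.equivFin ⟨v, ht e he v hv⟩, congrArg Subtype.val (t.equivFin.symm_apply_apply _)⟩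
  simpa only [integral_edgeProd_map, density, Measure.infinitePi_eq_pi] using h _ F

variable (H)

theorem labeledDensity_eq_rootedDensity (α : ℕ → Ω) (F : PartiallyLabeledMultigraph) :
    H.labeledDensity α F = H.rootedDensity α F.toMultigraph := by
  rw [PartiallyLabeledMultigraph.toMultigraph, rootedDensity_map_sumMap, rootedDensity,
    Measure.infinitePi_eq_pi]
  rfl

theorem rootedDensity_glue (α : U → Ω) (F : Multigraph (U ⊕ V)) (G : Multigraph (U ⊕ V')) :
    H.rootedDensity α (F.glue G) = H.rootedDensity α F * H.rootedDensity α G := by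
  have hsplit := measurePreserving_sumPiEquivProdPi_symm_infinitePi fun _ : V ⊕ V' => π
  rw [rootedDensity, rootedDensity, rootedDensity, ← integral_prod_mul, ← hsplit.integral_comp']
  congr 1
  funext p
  rw [Multigraph.glue, edgeProd_union, edgeProd_map, edgeProd_map]
  congr 2 <;> funext v <;> cases v <;> rfl

theorem rootedDensity_glueList {ι : Type*} {V : ι → Type*} (F : ∀ i, Multigraph (U ⊕ V i))
    (α : U → Ω) (l : List ι) : H.rootedDensity α (Multigraph.glueList F l).2 =
      (l.map fun i => H.rootedDensity α (F i)).prod := by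
  induction l with
  | nil =>
    exact (integral_const (1 : ℝ)).trans
      (by rw [probReal_univ, one_smul, List.map_nil, List.prod_nil])
  | cons i l ih => rw [Multigraph.glueList, rootedDensity_glue, ih, List.map_cons, List.prod_cons]

theorem abs_rootedDensity_le {C : ℝ} (hW : ∀ x y, |H.W x y| ≤ C) (α : U → Ω)
    (G : Multigraph (U ⊕ V)) : |H.rootedDensity α G| ≤ C ^ Multiset.card G.edges := by
  simpa only [rootedDensity, probReal_univ, mul_one, Real.norm_eq_abs] using
    norm_integral_le_of_norm_le_const (μ := Measure.infinitePi fun _ : V => π)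
      (f := fun x => H.edgeProd G (Sum.elim α x)) (.of_forall fun x => H.abs_edgeProd_le hW G _)

theorem integrable_edgeProd_sumElim (G : Multigraph (U ⊕ V)) :
    Integrable (fun p : (U → Ω) × (V → Ω) => H.edgeProd G (Sum.elim p.1 p.2))
      ((Measure.infinitePi fun _ : U => π).prod (Measure.infinitePi fun _ : V => π)) :=
  (measurePreserving_sumPiEquivProdPi_symm_infinitePi
    fun _ : U ⊕ V => π).integrable_comp_of_integrable (H.integrable_edgeProd G)

theorem aestronglyMeasurable_rootedDensity (G : Multigraph (U ⊕ V)) :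
    AEStronglyMeasurable (fun α => H.rootedDensity α G) (Measure.infinitePi fun _ : U => π) :=
  (H.integrable_edgeProd_sumElim G).aestronglyMeasurable.integral_prod_right'

theorem integral_rootedDensity (G : Multigraph (U ⊕ V)) :
    ∫ α, H.rootedDensity α G ∂(Measure.infinitePi fun _ : U => π) =
      ∫ x, H.edgeProd G x ∂(Measure.infinitePi fun _ : U ⊕ V => π) :=
  (integral_prod _ (H.integrable_edgeProd_sumElim G)).symm.trans
    ((measurePreserving_sumPiEquivProdPi_symm_infinitePi fun _ : U ⊕ V => π).integral_comp' _)

theorem abs_labeledDensity_le {C : ℝ} (hW : ∀ x y, |H.W x y| ≤ C) (α : ℕ → Ω)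
    (F : PartiallyLabeledMultigraph) :
    |H.labeledDensity α F| ≤ C ^ Multiset.card F.toMultigraph.edges :=
  H.labeledDensity_eq_rootedDensity α F ▸ H.abs_rootedDensity_le hW α F.toMultigraph

theorem aestronglyMeasurable_labeledDensity (F : PartiallyLabeledMultigraph) :
    AEStronglyMeasurable (fun α => H.labeledDensity α F) (Measure.infinitePi fun _ : ℕ => π) := by
  simpa only [labeledDensity_eq_rootedDensity] using
    H.aestronglyMeasurable_rootedDensity F.toMultigraph

/-- The compact space of families of possible values of the labeled densities `t_α(F, H)` of a
graphon `H` with values in `[-C, C]`. -/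
abbrev DensityProfile (C : ℝ) : Type :=
  ∀ F : PartiallyLabeledMultigraph, Set.Icc (-C ^ Multiset.card F.toMultigraph.edges)
    (C ^ Multiset.card F.toMultigraph.edges)

/-- The family of all labeled densities `t_α(F, H)` of the anchor sequence `α`. -/
noncomputable def densityProfile {C : ℝ} (hW : ∀ x y, |H.W x y| ≤ C) (α : ℕ → Ω) :
    DensityProfile C :=
  fun F => ⟨H.labeledDensity α F, abs_le.1 (H.abs_labeledDensity_le hW α F)⟩

theorem aemeasurable_densityProfile {C : ℝ} (hW : ∀ x y, |H.W x y| ≤ C) :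
    AEMeasurable (H.densityProfile hW) (Measure.infinitePi fun _ : ℕ => π) :=
  aemeasurable_pi_iff.2 fun F =>
    (H.aestronglyMeasurable_labeledDensity F).aemeasurable.subtype_mk

theorem integral_list_prod_labeledDensity (l : List PartiallyLabeledMultigraph) :
    ∫ α, (l.map (H.labeledDensity α)).prod ∂(Measure.infinitePi fun _ : ℕ => π) =
      ∫ x, H.edgeProd (Multigraph.glueList PartiallyLabeledMultigraph.toMultigraph l).2 x
        ∂(Measure.infinitePi fun _ => π) := by
  simp only [← integral_rootedDensity, rootedDensity_glueList, ← labeledDensity_eq_rootedDensity]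

variable {H} {H' : Graphon π'}

theorem map_densityProfile_eq_of_density_eq {C : ℝ} (hW : ∀ x y, |H.W x y| ≤ C)
    (hW' : ∀ x y, |H'.W x y| ≤ C)
    (h : ∀ (k : ℕ) (F : Multigraph (Fin k)), H.density F = H'.density F) :
    (Measure.infinitePi fun _ : ℕ => π).map (H.densityProfile hW) =
      (Measure.infinitePi fun _ : ℕ => π').map (H'.densityProfile hW') := by
  refine map_eq_map_of_integral_multiset_prod_eq (H.aemeasurable_densityProfile hW)
    (H'.aemeasurable_densityProfile hW')
    (fun F : PartiallyLabeledMultigraph => ⟨fun x => x F, by fun_prop⟩)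
    (fun x y hxy => funext fun F => Subtype.ext (hxy F)) fun m => ?_
  obtain ⟨l, rfl⟩ := m.exists_rep
  calc _ = ∫ α, (l.map (H.labeledDensity α)).prod ∂(Measure.infinitePi fun _ : ℕ => π) := rfl
    _ = ∫ β, (l.map (H'.labeledDensity β)).prod ∂(Measure.infinitePi fun _ : ℕ => π') := by
      rw [integral_list_prod_labeledDensity, integral_list_prod_labeledDensity,
        integral_edgeProd_eq_of_density_eq h]

theorem exists_isCoupling_labeledDensity_eq (hπ' : IsStandardBorelImage π')
    (h : ∀ (k : ℕ) (F : Multigraph (Fin k)), H.density F = H'.density F) :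
    ∃ γ : Measure ((ℕ → Ω) × (ℕ → Ω')),
      IsCoupling (Measure.infinitePi fun _ : ℕ => π) (Measure.infinitePi fun _ : ℕ => π') γ ∧
      ∀ᵐ p ∂γ, ∀ F : PartiallyLabeledMultigraph,
        H.labeledDensity p.1 F = H'.labeledDensity p.2 F := by
  obtain ⟨C, hC⟩ := H.bounded
  obtain ⟨C', hC'⟩ := H'.bounded
  have hW : ∀ x y, |H.W x y| ≤ max C C' := fun x y => (hC x y).trans (le_max_left _ _)
  have hW' : ∀ x y, |H'.W x y| ≤ max C C' := fun x y => (hC' x y).trans (le_max_right _ _)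
  obtain ⟨γ, hγ, heq⟩ := (IsStandardBorelImage.infinitePi fun _ : ℕ => hπ').exists_isCoupling_ae_eq
    (H.aemeasurable_densityProfile hW) (H'.aemeasurable_densityProfile hW')
    (map_densityProfile_eq_of_density_eq hW hW' h)
  exact ⟨γ, hγ, heq.mono fun p hp F => congrArg Subtype.val (congrFun hp F)⟩

end Graphon

/-! ### Tags of regular anchor sequences -/

theorem map_prodMap_of_aemeasurable {X Y X' Y' : Type*} [MeasurableSpace X] [MeasurableSpace Y]
    [MeasurableSpace X'] [MeasurableSpace Y'] {μ : Measure X} {ν : Measure Y} [SFinite μ]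
    [SFinite ν] {f : X → X'} {g : Y → Y'} (hf : AEMeasurable f μ) (hg : AEMeasurable g ν) :
    (μ.prod ν).map (Prod.map f g) = (μ.map f).prod (ν.map g) := by
  rw [Measure.map_congr hf.ae_eq_mk, Measure.map_congr hg.ae_eq_mk,
    Measure.map_prod_map _ _ hf.measurable_mk hg.measurable_mk]
  refine Measure.map_congr ?_
  filter_upwards [Measure.quasiMeasurePreserving_fst.ae_eq_comp hf.ae_eq_mk,
    Measure.quasiMeasurePreserving_snd.ae_eq_comp hg.ae_eq_mk] with p hp hp'
  exact Prod.ext hp hp'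

/-- The graph with two unlabeled nodes whose edges are listed by `m`: `none` stands for the edge
between the unlabeled nodes, and `some (Sum.inl i)`, `some (Sum.inr i)` for the edges from the first
and from the second unlabeled node to the node labeled `i`. -/
def Multigraph.doubleStar {U : Type*} (m : Multiset (Option (U ⊕ U))) : Multigraph (U ⊕ Fin 2) where
  edges := m.map fun c => c.elim s(Sum.inr 0, Sum.inr 1)
    (Sum.elim (fun i => s(Sum.inr 0, Sum.inl i)) fun i => s(Sum.inr 1, Sum.inl i))
  loopless := by
    intro e he
    obtain ⟨c, -, rfl⟩ := Multiset.mem_map.1 he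
    rcases c with _ | i | i <;> simp

namespace Graphon

variable {Ω Ω' : Type*} [MeasurableSpace Ω] [MeasurableSpace Ω'] {π : Measure Ω} {π' : Measure Ω'}
  {H : Graphon π} {H' : Graphon π'} {hH : H.UnitValued} {hH' : H'.UnitValued} {α : ℕ → Ω}
  {β : ℕ → Ω'}

theorem measurable_pushForward {Γ : Type*} [MeasurableSpace Γ] (H : Graphon π) (φ : Ω → Γ) :
    Measurable fun p : Γ × Γ => (H.pushForward φ).W p.1 p.2 := by
  have h : Measurable (H.pushDeriv φ) := Measure.measurable_rnDeriv _ _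
  have hswap : Measurable fun p : Γ × Γ => H.pushDeriv φ (p.2, p.1) := h.comp measurable_swap
  exact measurable_const.min ((h.ennreal_toReal.add hswap.ennreal_toReal).div_const 2)

/-- The tags of two points, together with the value of the graphon at this pair. -/
def tagPair (hH : H.UnitValued) (α : ℕ → Ω) (p : Ω × Ω) : ((ℕ → I) × (ℕ → I)) × I :=
  (Prod.map (H.tag hH α) (H.tag hH α) p, ⟨H.W p.1 p.2, hH p.1 p.2⟩)

/-- The coordinates of a value of `tagPair`, indexed like the edges of `Multigraph.doubleStar`. -/
def tagPairCoord : Option (ℕ ⊕ ℕ) → C(((ℕ → I) × (ℕ → I)) × I, ℝ)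
  | none => ⟨fun q => q.2, by fun_prop⟩
  | some (Sum.inl i) => ⟨fun q => q.1.1 i, by fun_prop⟩
  | some (Sum.inr i) => ⟨fun q => q.1.2 i, by fun_prop⟩

theorem tagPairCoord_separates {q r : ((ℕ → I) × (ℕ → I)) × I}
    (h : ∀ c, tagPairCoord c q = tagPairCoord c r) : q = r :=
  Prod.ext
    (Prod.ext (funext fun i => Subtype.ext (h (some (.inl i))))
      (funext fun i => Subtype.ext (h (some (.inr i)))))
    (Subtype.ext (h none))

theorem edgeProd_doubleStar (hH : H.UnitValued) (m : Multiset (Option (ℕ ⊕ ℕ))) (x : Fin 2 → Ω) :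
    H.edgeProd (.doubleStar m) (Sum.elim α x) =
      (m.map fun c => tagPairCoord c (tagPair hH α (x 0, x 1))).prod := by
  simp only [edgeProd, Multigraph.doubleStar, Multiset.map_map]
  congr 2
  funext c
  rcases c with _ | i | i <;> rfl

theorem aemeasurable_tagPair (hα : AEMeasurable (H.tag hH α) π) :
    AEMeasurable (tagPair hH α) (π.prod π) :=
  (hα.comp_fst.prodMk hα.comp_snd).prodMk H.nullMeasurable.aemeasurable.subtype_mk

theorem IsRegular.ae_map_tagPair (hα : H.IsRegular hH α) :
    ∀ᵐ q ∂((π.prod π).map (tagPair hH α)), (q.2 : ℝ) = (H.tagGraphon hH α).W q.1.1 q.1.2 := by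
  have hset : MeasurableSet {q : ((ℕ → I) × (ℕ → I)) × I |
      (q.2 : ℝ) = (H.tagGraphon hH α).W q.1.1 q.1.2} :=
    measurableSet_eq_fun (measurable_subtype_coe.comp measurable_snd)
      ((H.measurable_pushForward (H.tag hH α)).comp measurable_fst)
  exact (ae_map_iff (aemeasurable_tagPair hα.1.aemeasurable) hset).2 hα.2

variable [IsProbabilityMeasure π] [IsProbabilityMeasure π']

theorem map_fst_map_tagPair (hα : AEMeasurable (H.tag hH α) π) :
    ((π.prod π).map (tagPair hH α)).map Prod.fst =
      (H.tagMeasure hH α).prod (H.tagMeasure hH α) :=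
  (AEMeasurable.map_map_of_aemeasurable measurable_fst.aemeasurable
    (aemeasurable_tagPair hα)).trans (map_prodMap_of_aemeasurable hα hα)

theorem rootedDensity_eq_of_labeledDensity_eq
    (h : ∀ F, H.labeledDensity α F = H'.labeledDensity β F) {s : ℕ}
    (G : Multigraph (ℕ ⊕ Fin s)) : H.rootedDensity α G = H'.rootedDensity β G := by
  obtain ⟨t, ht⟩ := G.exists_finset_support
  obtain ⟨n, hn⟩ := t.toLeft.exists_nat_subset_range
  obtain ⟨G, rfl⟩ := Multigraph.exists_map_eq (Fin.valEmbedding.sumMap (.refl (Fin s))) G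
    fun e he v hv => by
      have hvt := ht e he v hv
      rcases v with i | j
      · exact ⟨Sum.inl ⟨i, Finset.mem_range.1 (hn (Finset.mem_toLeft.2 hvt))⟩, rfl⟩
      · exact ⟨Sum.inr j, rfl⟩
  have hG := h ⟨n, s, Fin.valEmbedding, G⟩
  rwa [labeledDensity_eq_rootedDensity, labeledDensity_eq_rootedDensity] at hG

theorem integral_prod_tagPairCoord (hα : AEMeasurable (H.tag hH α) π)
    (m : Multiset (Option (ℕ ⊕ ℕ))) :
    ∫ p, (m.map fun c => tagPairCoord c (tagPair hH α p)).prod ∂(π.prod π) =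
      H.rootedDensity α (.doubleStar m) := by
  have hm : Continuous fun q => (m.map fun c => tagPairCoord c q).prod :=
    continuous_multiset_prod m fun c _ => (tagPairCoord c).continuous
  have hpair := measurePreserving_eval_pair_infinitePi π (zero_ne_one (α := Fin 2))
  simp only [rootedDensity, edgeProd_doubleStar hH]
  exact (integral_comp_of_measurePreserving hpair (hm.comp_aestronglyMeasurable
    (aemeasurable_tagPair hα).aestronglyMeasurable)).symm

theorem map_tagPair_eq_of_labeledDensity_eq (hα : AEMeasurable (H.tag hH α) π)
    (hβ : AEMeasurable (H'.tag hH' β) π')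
    (h : ∀ F, H.labeledDensity α F = H'.labeledDensity β F) :
    (π.prod π).map (tagPair hH α) = (π'.prod π').map (tagPair hH' β) :=
  map_eq_map_of_integral_multiset_prod_eq (aemeasurable_tagPair hα) (aemeasurable_tagPair hβ)
    tagPairCoord (fun _ _ => tagPairCoord_separates) fun m => by
      rw [integral_prod_tagPairCoord hα, integral_prod_tagPairCoord hβ,
        rootedDensity_eq_of_labeledDensity_eq h]

theorem IsRegular.tagMeasure_eq_and_ae_eq (hα : H.IsRegular hH α) (hβ : H'.IsRegular hH' β)
    (h : ∀ F, H.labeledDensity α F = H'.labeledDensity β F) :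
    H.tagMeasure hH α = H'.tagMeasure hH' β ∧
      ∀ᵐ p ∂((H.tagMeasure hH α).prod (H.tagMeasure hH α)),
        (H.tagGraphon hH α).W p.1 p.2 = (H'.tagGraphon hH' β).W p.1 p.2 := by
  have hα' := hα.1.aemeasurable
  have hβ' := hβ.1.aemeasurable
  have hlaw := map_tagPair_eq_of_labeledDensity_eq hα' hβ' h
  have : IsProbabilityMeasure (H.tagMeasure hH α) := Measure.isProbabilityMeasure_map hα'
  have : IsProbabilityMeasure (H'.tagMeasure hH' β) := Measure.isProbabilityMeasure_map hβ'
  have htags : (H.tagMeasure hH α).prod (H.tagMeasure hH α) =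
      (H'.tagMeasure hH' β).prod (H'.tagMeasure hH' β) := by
    rw [← map_fst_map_tagPair hα', ← map_fst_map_tagPair hβ', hlaw]
  refine ⟨by simpa only [Measure.fst_prod] using congrArg Measure.fst htags, ?_⟩
  have hset : MeasurableSet {p : (ℕ → I) × (ℕ → I) |
      (H.tagGraphon hH α).W p.1 p.2 = (H'.tagGraphon hH' β).W p.1 p.2} :=
    measurableSet_eq_fun (H.measurable_pushForward (H.tag hH α))
      (H'.measurable_pushForward (H'.tag hH' β))
  rw [← map_fst_map_tagPair hα', ae_map_iff measurable_fst.aemeasurable hset]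
  filter_upwards [hα.ae_map_tagPair, hlaw ▸ hβ.ae_map_tagPair] with q hq hq'
  exact hq.symm.trans hq'

end Graphon

theorem lemma5p3_general {Ω Ω' : Type*} [MeasurableSpace Ω] [MeasurableSpace Ω']
    (π : Measure Ω) (π' : Measure Ω') [IsProbabilityMeasure π] [IsProbabilityMeasure π']
    (H : Graphon π) (H' : Graphon π') :
    (IsStandardBorelImage π' →
      (∀ (k : ℕ) (F : Multigraph (Fin k)), H.density F = H'.density F) →
      ∃ γ : Measure ((ℕ → Ω) × (ℕ → Ω')),
        IsCoupling (Measure.infinitePi fun _ : ℕ => π) (Measure.infinitePi fun _ : ℕ => π') γ ∧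
        ∀ᵐ p ∂γ, ∀ F : PartiallyLabeledMultigraph,
          H.labeledDensity p.1 F = H'.labeledDensity p.2 F) ∧
    (∀ (hH : H.UnitValued) (hH' : H'.UnitValued) (α : ℕ → Ω) (β : ℕ → Ω'),
      H.IsRegular hH α → H'.IsRegular hH' β →
      (∀ F : PartiallyLabeledMultigraph, H.labeledDensity α F = H'.labeledDensity β F) →
      H.tagMeasure hH α = H'.tagMeasure hH' β ∧
      ∀ᵐ p ∂((H.tagMeasure hH α).prod (H.tagMeasure hH α)),
        (H.tagGraphon hH α).W p.1 p.2 = (H'.tagGraphon hH' β).W p.1 p.2) :=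
  ⟨Graphon.exists_isCoupling_labeledDensity_eq,
    fun _ _ _ _ hα hβ h => hα.tagMeasure_eq_and_ae_eq hβ h⟩

theorem lemma5p3 {Ω Ω' : Type*} [MeasurableSpace Ω] [MeasurableSpace Ω']
    (π : Measure Ω) (π' : Measure Ω') [IsProbabilityMeasure π] [IsProbabilityMeasure π']
    (H : Graphon π) (H' : Graphon π') :
    -- coupling of anchor sequences
    (IsLebesgueSpace π → IsLebesgueSpace π' →
      (∀ (k : ℕ) (F : Multigraph (Fin k)), H.density F = H'.density F) →
      ∃ γ : Measure ((ℕ → Ω) × (ℕ → Ω')),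
        IsCoupling (Measure.infinitePi fun _ : ℕ => π) (Measure.infinitePi fun _ : ℕ => π') γ ∧
        ∀ᵐ p ∂γ, ∀ F : PartiallyLabeledMultigraph,
          H.labeledDensity p.1 F = H'.labeledDensity p.2 F) ∧
    -- regular anchor sequences with equal labeled densities
    (∀ (hH : H.UnitValued) (hH' : H'.UnitValued) (α : ℕ → Ω) (β : ℕ → Ω'),
      H.IsRegular hH α → H'.IsRegular hH' β →
      (∀ F : PartiallyLabeledMultigraph, H.labeledDensity α F = H'.labeledDensity β F) →
      H.tagMeasure hH α = H'.tagMeasure hH' β ∧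
      ∀ᵐ p ∂((H.tagMeasure hH α).prod (H.tagMeasure hH α)),
        (H.tagGraphon hH α).W p.1 p.2 = (H'.tagGraphon hH' β).W p.1 p.2) := by
  exact (lemma5p3_general π π' H H').imp_left fun h _ hπ' => h hπ'.isStandardBorelImage
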